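/- Let $f(1)<f(2)<f(3)<\cdots$ be a strictly increasing sequence of natural numbers such that $f(n)=O(n^{\tau})$ as $n\to\infty$ for some real number $\tau\ge 1$, and let $\alpha\in(1/2,1)$. For $x\in[0,1]$ and $N\in\mathbb N$ put $$V_f(x;N)=\sum_{n=1}^{N}e^{2\pi i x f(n)},$$ and let $$\mathcal F_{f,\alpha}=\{x\in[0,1] : |V_f(x;N)|\ge N^{\alpha}\text{ for infinitely many } N\in\mathbb N\}.$$ Then the Hausdorff dimension of $\mathcal F_{f,\alpha}$ satisfies $$\dim\mathcal F_{f,\alpha}\le 1-\frac{2\alpha-1}{\tau}.$$ -/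

import Mathlib

open Filter Asymptotics

/-- The exponential sum `V_f(x; N) = ∑_{n=1}^{N} e(x f(n))` with `e(z) = exp(2πiz)`, for a real
sequence `f(1), f(2), …` (the value of `f` at `0` plays no role). -/
noncomputable def expSum (f : ℕ → ℝ) (x : ℝ) (N : ℕ) : ℂ :=
  ∑ n ∈ Finset.Icc 1 N, Complex.exp (2 * Real.pi * Complex.I * ((x * f n : ℝ) : ℂ))

/-- The set of `x ∈ [0, 1]` with `|V_f(x; N)| ≥ N^α` for infinitely many positive integers `N`. -/
def largeSumSet (f : ℕ → ℝ) (α : ℝ) : Set ℝ :=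
  {x : ℝ | x ∈ Set.Icc (0 : ℝ) 1 ∧
    {N : ℕ | 1 ≤ N ∧ (N : ℝ) ^ α ≤ ‖expSum f x N‖}.Infinite}

/-!
Fix a scale `K = 2 ^ k` and an integer `F > f K`. All the sums `V_f(x; N)` with `N ≤ K` have
frequencies in `[0, F]`, so they are essentially constant on the `F` cells `[r / F, (r + 1) / F]`.
The argument counts the cells that contain a point where some `V_f(x; N)`, `N ≤ K`, is large.

* Gallagher's form of the large sieve, `sum_norm_sq_trigSum_le`: for a block `A` of indices and one
  point `x r` in each cell, `∑ r, |∑ n ∈ A, e(x r * f n)| ^ 2 ≪ F * #A`. It combines a Sobolev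
  inequality on each cell (`norm_sq_le_integral_add_integral_deriv`) with Parseval on `[0, 1]`
  (`integral_norm_sq_trigSum`); the latter is where the injectivity of `f` enters.
* The Rademacher–Menshov device, `norm_sq_sum_range_le_sum_dyadic`: every initial segment of
  `[1, K]` is a disjoint union of at most `k + 1` dyadic blocks. Hence the large sieve holds with
  the length `N r ≤ K` also depending on `r`, at the cost of a factor `(k + 1) ^ 2`
  (`sum_norm_sq_expSum_le`).

By Chebyshev, the number of cells on which `|V_f(x; N)| ≥ N ^ α` happens for some `N` between
`K / 2` and `K` is `≪ k ^ 2 * F * K ^ (1 - 2 * α)` (`card_largeCells_le`). Taking `F = f K + 1`,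
which is `O(K ^ τ)`, these cells have total `s`-dimensional size
`≪ k ^ 2 * K ^ (1 - 2 * α + τ * (1 - s))`, which is summable over `k` as soon as
`s > 1 - (2 * α - 1) / τ` (`summable_card_largeCells_mul`). For each `n`, the cells of all scales
`k ≥ n` cover the limsup set, so its `s`-dimensional Hausdorff measure is finite.
-/

/-! ### Mean values of trigonometric sums -/

/-- The trigonometric sum `∑ n ∈ A, c n * e(x * f n)`, where `e(z) = exp(2πiz)`. -/
noncomputable def trigSum (f : ℕ → ℕ) (A : Finset ℕ) (c : ℕ → ℂ) (x : ℝ) : ℂ :=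
  ∑ n ∈ A, c n * Complex.exp (2 * Real.pi * Complex.I * ((x * (f n : ℝ) : ℝ) : ℂ))

theorem hasDerivAt_trigSum (f : ℕ → ℕ) (A : Finset ℕ) (c : ℕ → ℂ) (x : ℝ) :
    HasDerivAt (trigSum f A c)
      (trigSum f A (fun n => c n * (2 * Real.pi * Complex.I * (f n : ℂ))) x) x := by
  unfold trigSum
  apply HasDerivAt.fun_sum
  intro n _
  have h1 : HasDerivAt (fun y : ℝ => ((y * (f n : ℝ) : ℝ) : ℂ)) (f n : ℂ) x := by
    have := ((hasDerivAt_id x).mul_const (f n : ℝ)).ofReal_comp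
    simpa using this
  have h2 := ((h1.const_mul (2 * Real.pi * Complex.I)).cexp).const_mul (c n)
  refine h2.congr_deriv ?_
  ring

theorem continuous_trigSum (f : ℕ → ℕ) (A : Finset ℕ) (c : ℕ → ℂ) :
    Continuous (trigSum f A c) :=
  continuous_iff_continuousAt.2 fun x => (hasDerivAt_trigSum f A c x).continuousAt

theorem integral_exp_two_pi_mul_int (m : ℤ) :
    ∫ x in (0 : ℝ)..1, Complex.exp (2 * Real.pi * Complex.I * m * x) = if m = 0 then 1 else 0 := by
  split_ifs with hm
  · simp [hm]
  · have hc : (2 * Real.pi * Complex.I * m : ℂ) ≠ 0 :=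
      mul_ne_zero Complex.two_pi_I_ne_zero (by exact_mod_cast hm)
    rw [integral_exp_mul_complex hc]
    have : Complex.exp (2 * Real.pi * Complex.I * m) = 1 := by
      rw [mul_comm]; exact Complex.exp_int_mul_two_pi_mul_I m
    simp [this]

/-- Parseval's identity for a trigonometric sum with distinct frequencies. -/
theorem integral_norm_sq_trigSum (f : ℕ → ℕ) (A : Finset ℕ) (hf : Set.InjOn f A) (c : ℕ → ℂ) :
    ∫ x in (0 : ℝ)..1, ‖trigSum f A c x‖ ^ 2 = ∑ n ∈ A, ‖c n‖ ^ 2 := by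
  have key : ∀ x : ℝ, ((‖trigSum f A c x‖ ^ 2 : ℝ) : ℂ) = ∑ m ∈ A, ∑ n ∈ A,
      c m * (starRingEnd ℂ) (c n) *
        Complex.exp (2 * Real.pi * Complex.I * ((f m : ℤ) - (f n : ℤ) : ℤ) * x) := by
    intro x
    push_cast
    rw [← Complex.mul_conj', trigSum, map_sum, Finset.sum_mul_sum]
    refine Finset.sum_congr rfl fun m _ => Finset.sum_congr rfl fun n _ => ?_
    rw [map_mul, ← Complex.exp_conj, mul_mul_mul_comm, ← Complex.exp_add]
    congr 2
    simp only [map_mul, Complex.conj_ofReal, Complex.conj_I, Complex.conj_ofNat]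
    push_cast
    ring
  apply Complex.ofReal_injective
  rw [← intervalIntegral.integral_ofReal]
  simp_rw [key]
  rw [intervalIntegral.integral_finsetSum
    (fun m _ => (Continuous.intervalIntegrable (by fun_prop) _ _))]
  rw [Complex.ofReal_sum]
  refine Finset.sum_congr rfl fun m hm => ?_
  rw [intervalIntegral.integral_finsetSum
    (fun m _ => (Continuous.intervalIntegrable (by fun_prop) _ _))]
  simp_rw [intervalIntegral.integral_const_mul, integral_exp_two_pi_mul_int]
  rw [Finset.sum_eq_single_of_mem m hm]
  · simp [Complex.mul_conj']
  · intro n hn hne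
    have : ¬ ((f m : ℤ) - f n = 0) := fun h =>
      hne (hf hn hm (by exact_mod_cast (sub_eq_zero.1 h).symm))
    simp [this]

/-! ### The large sieve on a grid -/

/-- Gallagher's Sobolev-type inequality: a pointwise bound by local `L²` norms of the function and
its derivative, weighted by the length of the interval. -/
theorem norm_sq_le_integral_add_integral_deriv {g g' : ℝ → ℂ} (hg : ∀ x, HasDerivAt g (g' x) x)
    (hg' : Continuous g') {a b x : ℝ} (hab : a < b) (hx : x ∈ Set.Icc a b) :
    ‖g x‖ ^ 2 ≤ 2 / (b - a) * (∫ y in a..b, ‖g y‖ ^ 2) + (b - a) * ∫ y in a..b, ‖g' y‖ ^ 2 := by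
  have hL : 0 < b - a := sub_pos.2 hab
  have hgc : Continuous g := continuous_iff_continuousAt.2 fun x => (hg x).continuousAt
  -- By AM-GM with weight `b - a`, `w` dominates the derivative of `‖g‖ ^ 2`.
  set w : ℝ → ℝ := fun y => ‖g y‖ ^ 2 / (b - a) + (b - a) * ‖g' y‖ ^ 2 with hw
  have hwc : Continuous w := by fun_prop
  have hw0 : ∀ y, 0 ≤ w y := fun y => by positivity
  have hder : ∀ y, HasDerivAt (fun y => ‖g y‖ ^ 2) (2 * inner ℝ (g y) (g' y)) y :=
    fun y => (hg y).norm_sq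
  have hbd : ∀ y, |2 * inner ℝ (g y) (g' y)| ≤ w y := by
    intro y
    rw [abs_mul, abs_two]
    have h1 := abs_real_inner_le_norm (g y) (g' y)
    have h2 : 2 * (‖g y‖ * ‖g' y‖) ≤ w y := by
      have h3 : w y - 2 * (‖g y‖ * ‖g' y‖) = (‖g y‖ - (b - a) * ‖g' y‖) ^ 2 / (b - a) := by
        simp only [hw]; field_simp; ring
      have h4 : 0 ≤ (‖g y‖ - (b - a) * ‖g' y‖) ^ 2 / (b - a) := by positivity
      linarith
    linarith
  have hosc : ∀ y ∈ Set.Icc a b, ‖g x‖ ^ 2 ≤ ‖g y‖ ^ 2 + ∫ z in a..b, w z := by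
    intro y hy
    have hc : Continuous fun y => 2 * inner ℝ (g y) (g' y) := by fun_prop
    have h1 := intervalIntegral.integral_eq_sub_of_hasDerivAt (a := y) (b := x)
      (fun z _ => hder z) (hc.intervalIntegrable _ _)
    have h2 : ‖∫ z in y..x, 2 * inner ℝ (g z) (g' z)‖ ≤ |∫ z in y..x, w z| :=
      intervalIntegral.norm_integral_le_abs_of_norm_le (Eventually.of_forall fun z => hbd z)
        (hwc.intervalIntegrable _ _)
    have h3 : |∫ z in y..x, w z| ≤ |∫ z in a..b, w z| :=
      intervalIntegral.abs_integral_mono_interval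
        (by
          rw [Set.uIoc_of_le hab.le]
          exact Set.Ioc_subset_Ioc (le_min hy.1 hx.1) (max_le hy.2 hx.2))
        (Eventually.of_forall hw0) (hwc.intervalIntegrable _ _)
    rw [abs_of_nonneg (intervalIntegral.integral_nonneg hab.le fun z _ => hw0 z)] at h3
    have h4 := le_abs_self (∫ z in y..x, 2 * inner ℝ (g z) (g' z))
    rw [Real.norm_eq_abs] at h2
    linarith
  -- Averaging over the base point `y` removes the dependence on it.
  have havg : ∫ _ in a..b, ‖g x‖ ^ 2 ≤ ∫ y in a..b, (‖g y‖ ^ 2 + ∫ z in a..b, w z) :=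
    intervalIntegral.integral_mono_on hab.le (by simp)
      (Continuous.intervalIntegrable (by fun_prop) _ _) hosc
  have hwi : ∫ z in a..b, w z
      = (∫ y in a..b, ‖g y‖ ^ 2) / (b - a) + (b - a) * ∫ y in a..b, ‖g' y‖ ^ 2 := by
    simp only [hw]
    rw [intervalIntegral.integral_add (Continuous.intervalIntegrable (by fun_prop) _ _)
      (Continuous.intervalIntegrable (by fun_prop) _ _),
      intervalIntegral.integral_div, intervalIntegral.integral_const_mul]
  rw [intervalIntegral.integral_add (Continuous.intervalIntegrable (by fun_prop) _ _)
      (by simp), intervalIntegral.integral_const, intervalIntegral.integral_const,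
      smul_eq_mul, smul_eq_mul, hwi] at havg
  rw [← mul_le_mul_iff_right₀ hL]
  calc _ ≤ _ := havg
    _ = _ := by field_simp; ring

/-- The `r`-th cell `[r / F, (r + 1) / F]` of the subdivision of `[0, 1]` into `F` closed
intervals. -/
def gridCell (F r : ℕ) : Set ℝ := Set.Icc ((r : ℝ) / F) ((r + 1 : ℝ) / F)

theorem sum_integral_gridCell {F : ℕ} (hF : 0 < F) {h : ℝ → ℝ} (hh : Continuous h) :
    ∑ r ∈ Finset.range F, ∫ x in ((r : ℝ) / F)..((r + 1 : ℝ) / F), h x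
      = ∫ x in (0 : ℝ)..1, h x := by
  have := intervalIntegral.sum_integral_adjacent_intervals (f := h) (μ := MeasureTheory.volume)
    (a := fun r : ℕ => (r : ℝ) / F) (n := F) (fun k _ => hh.intervalIntegrable _ _)
  have hF' : (F : ℝ) ≠ 0 := by positivity
  simpa [div_self hF'] using this

/-- The large sieve inequality for one sample point in each cell. No separation between the points
is needed, since the cells overlap only at end points. -/
theorem sum_norm_sq_trigSum_le {f : ℕ → ℕ} {A : Finset ℕ} (hf : Set.InjOn f A) {F : ℕ} (hF : 0 < F)
    (hfF : ∀ n ∈ A, f n ≤ F) {x : ℕ → ℝ} (hx : ∀ r < F, x r ∈ gridCell F r) :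
    ∑ r ∈ Finset.range F, ‖trigSum f A 1 (x r)‖ ^ 2 ≤ (2 + 4 * Real.pi ^ 2) * F * A.card := by
  have hF' : (0 : ℝ) < F := by exact_mod_cast hF
  -- The coefficients of the derivative of the sum.
  set c' : ℕ → ℂ := fun n => (1 : ℕ → ℂ) n * (2 * Real.pi * Complex.I * (f n : ℂ)) with hc'
  have h1 : ∀ r ∈ Finset.range F, ‖trigSum f A 1 (x r)‖ ^ 2 ≤
      2 * F * (∫ y in ((r : ℝ) / F)..((r + 1 : ℝ) / F), ‖trigSum f A 1 y‖ ^ 2)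
      + 1 / F * (∫ y in ((r : ℝ) / F)..((r + 1 : ℝ) / F), ‖trigSum f A c' y‖ ^ 2) := by
    intro r hr
    have hlt : (r : ℝ) / F < (r + 1 : ℝ) / F := by gcongr; linarith
    have := norm_sq_le_integral_add_integral_deriv (hasDerivAt_trigSum f A 1)
      (continuous_trigSum f A c') hlt (hx r (Finset.mem_range.1 hr))
    have hsub : (r + 1 : ℝ) / F - r / F = 1 / F := by ring
    rw [hsub] at this
    simpa only [div_div_eq_mul_div, div_one] using this
  refine (Finset.sum_le_sum h1).trans ?_
  have hc1 : Continuous fun y => ‖trigSum f A 1 y‖ ^ 2 := (continuous_trigSum f A 1).norm.pow 2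
  have hc2 : Continuous fun y => ‖trigSum f A c' y‖ ^ 2 := (continuous_trigSum f A c').norm.pow 2
  rw [Finset.sum_add_distrib, ← Finset.mul_sum, ← Finset.mul_sum, sum_integral_gridCell hF hc1,
    sum_integral_gridCell hF hc2, integral_norm_sq_trigSum f A hf, integral_norm_sq_trigSum f A hf]
  have h2 : ∑ n ∈ A, ‖c' n‖ ^ 2 ≤ A.card * (2 * Real.pi * F) ^ 2 := by
    rw [← nsmul_eq_mul]
    refine Finset.sum_le_card_nsmul _ _ _ fun n hn => ?_
    have : (f n : ℝ) ≤ F := by exact_mod_cast hfF n hn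
    have h3 : ‖c' n‖ = 2 * Real.pi * f n := by
      simp [hc', abs_of_pos Real.pi_pos]
    rw [h3]
    have := Real.pi_pos
    gcongr
  calc _ ≤ 2 * F * (A.card : ℝ) + 1 / F * (A.card * (2 * Real.pi * F) ^ 2) := by
        gcongr
        simp
    _ = _ := by field_simp; ring

/-! ### The maximal large sieve -/

/-- The Rademacher–Menshov decomposition: a partial sum of length at most `2 ^ k` is controlled, in
the square, by the sums over all dyadic blocks of `[0, 2 ^ k)`. -/
theorem norm_sq_sum_range_le_sum_dyadic (a : ℕ → ℂ) {N k : ℕ} (hN : N ≤ 2 ^ k) :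
    ‖∑ n ∈ Finset.range N, a n‖ ^ 2 ≤ (k + 1) * ∑ j ∈ Finset.range (k + 1),
      ∑ b ∈ Finset.range (2 ^ (k - j)), ‖∑ n ∈ Finset.Ico (b * 2 ^ j) ((b + 1) * 2 ^ j), a n‖ ^ 2 := by
  -- `S j` is the partial sum whose length is `N` with its last `j` binary digits cleared, so that
  -- `S j - S (j + 1)` is zero or one dyadic block of level `j`, according to the `j`-th digit.
  set S : ℕ → ℂ := fun j => ∑ n ∈ Finset.range (N / 2 ^ j * 2 ^ j), a n with hS
  have hlast : S (k + 1) = 0 := by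
    have : N / 2 ^ (k + 1) = 0 := Nat.div_eq_of_lt (by rw [pow_succ]; have := Nat.two_pow_pos k; omega)
    simp [hS, this]
  have htel : ∑ n ∈ Finset.range N, a n = ∑ j ∈ Finset.range (k + 1), (S j - S (j + 1)) := by
    rw [Finset.sum_range_sub', hlast]; simp [hS]
  have hstep : ∀ j ∈ Finset.range (k + 1), ‖S j - S (j + 1)‖ ^ 2 ≤
      ∑ b ∈ Finset.range (2 ^ (k - j)),
        ‖∑ n ∈ Finset.Ico (b * 2 ^ j) ((b + 1) * 2 ^ j), a n‖ ^ 2 := by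
    intro j hj
    have hjk : j ≤ k := Nat.lt_succ_iff.1 (Finset.mem_range.1 hj)
    have hdiv : N / 2 ^ (j + 1) = N / 2 ^ j / 2 := by rw [pow_succ, Nat.div_div_eq_div_mul]
    have hmul : N / 2 ^ (j + 1) * 2 ^ (j + 1) = (N / 2 ^ j / 2 * 2) * 2 ^ j := by
      rw [hdiv, pow_succ]; ring
    have hle : N / 2 ^ j ≤ 2 ^ (k - j) := by
      rw [← Nat.pow_div hjk two_pos]; exact Nat.div_le_div_right hN
    rcases Nat.even_or_odd' (N / 2 ^ j) with ⟨m, hm | hm⟩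
    · have : S j = S (j + 1) := by
        simp only [hS]; rw [hmul, hm]; congr 3; omega
      rw [this, sub_self]
      simpa using Finset.sum_nonneg fun _ _ => by positivity
    · have h2 : N / 2 ^ j / 2 * 2 = 2 * m := by omega
      have : S j - S (j + 1) = ∑ n ∈ Finset.Ico ((2 * m) * 2 ^ j) ((2 * m + 1) * 2 ^ j), a n := by
        simp only [hS]; rw [hmul, h2, hm, Finset.sum_Ico_eq_sub _ (by gcongr; omega)]
      rw [this]
      exact Finset.single_le_sum
        (f := fun b => ‖∑ n ∈ Finset.Ico (b * 2 ^ j) ((b + 1) * 2 ^ j), a n‖ ^ 2)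
        (fun _ _ => by positivity) (Finset.mem_range.2 (by omega))
  rw [htel]
  calc _ ≤ (∑ j ∈ Finset.range (k + 1), ‖S j - S (j + 1)‖) ^ 2 := by
        gcongr; exact norm_sum_le _ _
    _ ≤ (k + 1) * ∑ j ∈ Finset.range (k + 1), ‖S j - S (j + 1)‖ ^ 2 := by
        simpa using sq_sum_le_card_mul_sum_sq (s := Finset.range (k + 1))
          (f := fun j => ‖S j - S (j + 1)‖)
    _ ≤ _ := by gcongr with j hj; exact hstep j hj

/-- The maximal form of the large sieve: both the sample point and the length of the sum may depend
on the cell. -/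
theorem sum_norm_sq_expSum_le {f : ℕ → ℕ} {k : ℕ} (hf : Set.InjOn f (Set.Icc 1 (2 ^ k)))
    {F : ℕ} (hF : 0 < F) (hfF : ∀ n ∈ Set.Icc 1 (2 ^ k), f n ≤ F) {x : ℕ → ℝ}
    (hx : ∀ r < F, x r ∈ gridCell F r) {N : ℕ → ℕ} (hN : ∀ r, N r ≤ 2 ^ k) :
    ∑ r ∈ Finset.range F, ‖expSum (fun n => (f n : ℝ)) (x r) (N r)‖ ^ 2
      ≤ (2 + 4 * Real.pi ^ 2) * (k + 1) ^ 2 * F * 2 ^ k := by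
  have hrange : ∀ r, expSum (fun n => (f n : ℝ)) (x r) (N r) = ∑ n ∈ Finset.range (N r),
      Complex.exp (2 * Real.pi * Complex.I * ((x r * (f (n + 1) : ℝ) : ℝ) : ℂ)) := by
    intro r
    rw [expSum, Finset.range_eq_Ico, Finset.sum_Ico_add' (fun n =>
      Complex.exp (2 * Real.pi * Complex.I * ((x r * (f n : ℝ) : ℝ) : ℂ))) 0 (N r) 1]
    rfl
  have hblock : ∀ j ∈ Finset.range (k + 1), ∀ b ∈ Finset.range (2 ^ (k - j)),
      ∑ r ∈ Finset.range F, ‖∑ n ∈ Finset.Ico (b * 2 ^ j) ((b + 1) * 2 ^ j),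
        Complex.exp (2 * Real.pi * Complex.I * ((x r * (f (n + 1) : ℝ) : ℝ) : ℂ))‖ ^ 2
      ≤ (2 + 4 * Real.pi ^ 2) * F * 2 ^ j := by
    intro j hj b hb
    have hjk : j ≤ k := Nat.lt_succ_iff.1 (Finset.mem_range.1 hj)
    have hmem : ∀ n ∈ Finset.Ico (b * 2 ^ j) ((b + 1) * 2 ^ j), n + 1 ∈ Set.Icc 1 (2 ^ k) := by
      intro n hn
      have h1 : (b + 1) * 2 ^ j ≤ 2 ^ (k - j) * 2 ^ j :=
        Nat.mul_le_mul_right _ (Finset.mem_range.1 hb)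
      rw [← pow_add, Nat.sub_add_cancel hjk] at h1
      have := (Finset.mem_Ico.1 hn).2
      exact ⟨by omega, by omega⟩
    have := sum_norm_sq_trigSum_le (f := fun n => f (n + 1))
      (A := Finset.Ico (b * 2 ^ j) ((b + 1) * 2 ^ j))
      (fun m hm n hn h => by simpa using hf (hmem m hm) (hmem n hn) h) hF
      (fun n hn => hfF _ (hmem n hn)) hx
    have hcard : (b + 1) * 2 ^ j - b * 2 ^ j = 2 ^ j := by rw [← Nat.sub_mul]; simp
    simpa [trigSum, hcard] using this
  have h1 : ∀ r ∈ Finset.range F, ‖expSum (fun n => (f n : ℝ)) (x r) (N r)‖ ^ 2 ≤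
      (k + 1) * ∑ j ∈ Finset.range (k + 1), ∑ b ∈ Finset.range (2 ^ (k - j)),
        ‖∑ n ∈ Finset.Ico (b * 2 ^ j) ((b + 1) * 2 ^ j),
        Complex.exp (2 * Real.pi * Complex.I * ((x r * (f (n + 1) : ℝ) : ℝ) : ℂ))‖ ^ 2 := by
    intro r _
    rw [hrange]
    exact norm_sq_sum_range_le_sum_dyadic _ (hN r)
  refine (Finset.sum_le_sum h1).trans ?_
  rw [← Finset.mul_sum, Finset.sum_comm]
  have h2 : ∀ j ∈ Finset.range (k + 1), ∑ r ∈ Finset.range F, ∑ b ∈ Finset.range (2 ^ (k - j)),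
        ‖∑ n ∈ Finset.Ico (b * 2 ^ j) ((b + 1) * 2 ^ j),
        Complex.exp (2 * Real.pi * Complex.I * ((x r * (f (n + 1) : ℝ) : ℝ) : ℂ))‖ ^ 2
      ≤ (2 + 4 * Real.pi ^ 2) * F * 2 ^ k := by
    intro j hj
    have hjk : j ≤ k := Nat.lt_succ_iff.1 (Finset.mem_range.1 hj)
    rw [Finset.sum_comm]
    refine (Finset.sum_le_card_nsmul _ _ _ (hblock j hj)).trans_eq ?_
    rw [Finset.card_range, nsmul_eq_mul, ← Nat.sub_add_cancel hjk, pow_add]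
    push_cast
    simp
    ring
  calc _ ≤ (k + 1 : ℝ) * ((k + 1) * ((2 + 4 * Real.pi ^ 2) * F * 2 ^ k)) := by
        gcongr
        simpa using Finset.sum_le_card_nsmul _ _ _ h2
    _ = _ := by ring

/-! ### Cells on which the sums are large -/

/-- The number `f (2 ^ (k + 1)) + 1` of cells used at scale `k`. It exceeds every frequency of the
sums of length at most `2 ^ (k + 1)`. -/
def cellCount (f : ℕ → ℕ) (k : ℕ) : ℕ := f (2 ^ (k + 1)) + 1

open Classical in
/-- The indices of the cells at scale `k` that contain a point `x` with `|V_f(x; N)| ≥ N ^ α` for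
some `2 ^ k ≤ N ≤ 2 ^ (k + 1)`. -/
noncomputable def largeCells (f : ℕ → ℕ) (α : ℝ) (k : ℕ) : Finset ℕ :=
  {r ∈ Finset.range (cellCount f k) | ∃ x ∈ gridCell (cellCount f k) r, ∃ N : ℕ,
    2 ^ k ≤ N ∧ N ≤ 2 ^ (k + 1) ∧ (N : ℝ) ^ α ≤ ‖expSum (fun n => (f n : ℝ)) x N‖}

theorem card_largeCells_le {f : ℕ → ℕ} (hf : StrictMonoOn f (Set.Ici 1)) {α : ℝ} (hα : 0 ≤ α)
    (k : ℕ) : ((largeCells f α k).card : ℝ) * (((2 : ℝ) ^ k) ^ α) ^ 2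
      ≤ (2 + 4 * Real.pi ^ 2) * (k + 2) ^ 2 * cellCount f k * 2 ^ (k + 1) := by
  classical
  set F := cellCount f k with hFdef
  have hF : 0 < F := Nat.succ_pos _
  have hsub : Set.Icc 1 (2 ^ (k + 1)) ⊆ Set.Ici 1 := fun n hn => hn.1
  -- A witness is chosen in each large cell; the other cells get their left end point and the
  -- empty sum.
  have hch : ∀ r : ℕ, ∃ p : ℝ × ℕ, p.1 ∈ gridCell F r ∧ p.2 ≤ 2 ^ (k + 1) ∧
      (r ∈ largeCells f α k →
        ((2 : ℝ) ^ k) ^ α ≤ ‖expSum (fun n => (f n : ℝ)) p.1 p.2‖) := by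
    intro r
    by_cases hr : r ∈ largeCells f α k
    · obtain ⟨-, x, hx, N, hN1, hN2, hN3⟩ := Finset.mem_filter.1 hr
      refine ⟨(x, N), hx, hN2, fun _ => le_trans ?_ hN3⟩
      have : (2 : ℝ) ^ k ≤ N := by exact_mod_cast hN1
      gcongr
    · exact ⟨(r / F, 0), ⟨le_rfl, by dsimp only; gcongr; linarith⟩, Nat.zero_le _,
        fun h => absurd h hr⟩
  choose p hp1 hp2 hp3 using hch
  have h := sum_norm_sq_expSum_le (hf.injOn.mono hsub) hF
    (fun n hn => (hf.monotoneOn hn.1 (Set.mem_Ici.2 Nat.one_le_two_pow) hn.2).trans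
      (Nat.le_succ _)) (fun r _ => hp1 r) hp2
  rw [← nsmul_eq_mul]
  calc _ ≤ ∑ r ∈ largeCells f α k, ‖expSum (fun n => (f n : ℝ)) (p r).1 (p r).2‖ ^ 2 :=
        Finset.card_nsmul_le_sum _ _ _ fun r hr => by gcongr; exact hp3 r hr
    _ ≤ ∑ r ∈ Finset.range F, ‖expSum (fun n => (f n : ℝ)) (p r).1 (p r).2‖ ^ 2 :=
        Finset.sum_le_sum_of_subset_of_nonneg (Finset.filter_subset _ _) fun _ _ _ => by positivity
    _ ≤ _ := h
    _ = _ := by push_cast; ring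

theorem exists_mem_gridCell {F : ℕ} (hF : 0 < F) {x : ℝ} (hx : x ∈ Set.Icc (0 : ℝ) 1) :
    ∃ r < F, x ∈ gridCell F r := by
  have hF' : (0 : ℝ) < F := by exact_mod_cast hF
  -- The right end point `x = 1` belongs to the last cell, not to the one given by the floor.
  rcases hx.2.eq_or_lt with rfl | h1
  · refine ⟨F - 1, by omega, ?_, ?_⟩
    · rw [div_le_one hF']; exact_mod_cast Nat.sub_le _ _
    · rw [Nat.cast_pred hF, sub_add_cancel, div_self hF'.ne']
  · have h0 : 0 ≤ x * F := mul_nonneg hx.1 hF'.le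
    refine ⟨⌊x * F⌋₊, (Nat.floor_lt h0).2 (by nlinarith), ?_, ?_⟩
    · rw [div_le_iff₀ hF']; exact Nat.floor_le h0
    · rw [le_div_iff₀ hF']; exact (Nat.lt_floor_add_one _).le

theorem largeSumSet_subset_iUnion_gridCell (f : ℕ → ℕ) (α : ℝ) (n : ℕ) :
    largeSumSet (fun n => (f n : ℝ)) α ⊆
      ⋃ i : Σ k : ℕ, largeCells f α (n + k), gridCell (cellCount f (n + i.1)) i.2 := by
  classical
  rintro x ⟨hx, hinf⟩
  obtain ⟨N, ⟨hN1, hN⟩, hNn⟩ := hinf.exists_gt (2 ^ n)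
  have hN0 : N ≠ 0 := by omega
  have hk : n ≤ Nat.log 2 N := Nat.le_log_of_pow_le one_lt_two hNn.le
  obtain ⟨m, hm⟩ := Nat.exists_eq_add_of_le hk
  have hlo : 2 ^ (n + m) ≤ N := hm ▸ Nat.pow_log_le_self 2 hN0
  have hhi : N ≤ 2 ^ (n + m + 1) := hm ▸ (Nat.lt_pow_succ_log_self one_lt_two N).le
  obtain ⟨r, hr, hxr⟩ := exists_mem_gridCell (Nat.succ_pos (f (2 ^ (n + m + 1)))) hx
  exact Set.mem_iUnion.2 ⟨⟨m, r, Finset.mem_filter.2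
    ⟨Finset.mem_range.2 hr, x, hxr, N, hlo, hhi, hN⟩⟩, hxr⟩

/-! ### Hausdorff measure and dimension -/

theorem ediam_gridCell (F r : ℕ) : Metric.ediam (gridCell F r) = ENNReal.ofReal (1 / F) := by
  rw [gridCell, Real.ediam_Icc]
  congr 1
  ring

theorem tendsto_cellCount {f : ℕ → ℕ} (hf : StrictMonoOn f (Set.Ici 1)) :
    Tendsto (cellCount f) atTop atTop := by
  refine StrictMono.tendsto_atTop (strictMono_nat_of_lt_succ fun k => ?_)
  have := hf (Set.mem_Ici.2 Nat.one_le_two_pow) (Set.mem_Ici.2 Nat.one_le_two_pow)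
    (Nat.pow_lt_pow_right one_lt_two (Nat.lt_succ_self (k + 1)))
  simpa [cellCount] using this

/-- The covers of the limsup set have convergent total `s`-dimensional size: with `K = 2 ^ (k + 1)`,
the `k`-th term is `O((k + 2) ^ 2 * K ^ e)` for the negative exponent
`e = 1 - 2 * α + τ * (1 - s)`. The condition `s ≤ 1` allows the upper bound for the number of cells
to be raised to the power `1 - s`. -/
theorem summable_card_largeCells_mul {f : ℕ → ℕ} (hf : StrictMonoOn f (Set.Ici 1)) {τ : ℝ}
    (hτ : 0 < τ) (hO : (fun n : ℕ => (f n : ℝ)) =O[atTop] (fun n : ℕ => (n : ℝ) ^ τ))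
    {α : ℝ} (hα : 0 ≤ α) {s : ℝ} (hs : 1 - (2 * α - 1) / τ < s) (hs1 : s ≤ 1) :
    Summable fun k => ((largeCells f α k).card : ℝ) * (1 / (cellCount f k : ℝ)) ^ s := by
  have h2 : (0 : ℝ) < 2 := two_pos
  set e : ℝ := 1 - 2 * α + τ * (1 - s) with he
  have he0 : e < 0 := by
    have : 1 - s < (2 * α - 1) / τ := by linarith
    rw [lt_div_iff₀ hτ] at this
    linarith
  set ρ : ℝ := 2 ^ e with hρ
  have hρ0 : 0 < ρ := by positivity
  have hρ1 : ρ < 1 := Real.rpow_lt_one_of_one_lt_of_neg one_lt_two he0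
  have hsum : Summable fun k : ℕ => ((k : ℝ) + 2) ^ 2 * ρ ^ (k + 1) := by
    have h := summable_pow_mul_geometric_of_norm_lt_one 2 (r := ρ)
      (by rwa [Real.norm_of_nonneg hρ0.le])
    refine (((summable_nat_add_iff 2).2 h).mul_right ρ⁻¹).congr fun k => ?_
    push_cast
    rw [pow_succ ρ (k + 1)]
    field_simp
  have hF : (fun k => (cellCount f k : ℝ)) =O[atTop] fun k : ℕ => ((2 : ℝ) ^ (k + 1)) ^ τ := by
    have hone : (fun _ : ℕ => (1 : ℝ)) =O[atTop] fun n : ℕ => (n : ℝ) ^ τ := by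
      refine IsBigO.of_bound 1 (eventually_atTop.2 ⟨1, fun n hn => ?_⟩)
      have : (1 : ℝ) ≤ n := by exact_mod_cast hn
      have := Real.one_le_rpow this hτ.le
      rw [norm_one, one_mul, Real.norm_of_nonneg (by positivity)]
      exact this
    have ht : Tendsto (fun k : ℕ => 2 ^ (k + 1)) atTop (atTop : Filter ℕ) :=
      (tendsto_add_atTop_iff_nat 1).2 (tendsto_pow_atTop_atTop_of_one_lt one_lt_two)
    have := (hO.add hone).comp_tendsto ht
    simpa [Function.comp_def, cellCount] using this
  have hFs : (fun k => (cellCount f k : ℝ) ^ (1 - s)) =O[atTop]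
      fun k : ℕ => (((2 : ℝ) ^ (k + 1)) ^ τ) ^ (1 - s) :=
    hF.rpow (by linarith) (Eventually.of_forall fun k => by positivity)
  refine summable_of_isBigO_nat hsum ?_
  have hle : ∀ k : ℕ, ((largeCells f α k).card : ℝ) * (1 / (cellCount f k : ℝ)) ^ s ≤
      ((2 + 4 * Real.pi ^ 2) * 2 ^ (2 * α)) *
        ((((k : ℝ) + 2) ^ 2 * ((2 : ℝ) ^ (k + 1)) ^ (1 - 2 * α)) * (cellCount f k : ℝ) ^ (1 - s)) := by
    intro k
    have hFpos : (0 : ℝ) < cellCount f k := by exact_mod_cast Nat.succ_pos _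
    have hK : (0 : ℝ) < 2 ^ k := by positivity
    have h := card_largeCells_le hf hα k
    have hpos : 0 < (((2 : ℝ) ^ k) ^ α) ^ 2 := by positivity
    rw [← le_div_iff₀ hpos] at h
    refine (mul_le_mul_of_nonneg_right h (by positivity)).trans_eq ?_
    have e1 : (((2 : ℝ) ^ k) ^ α) ^ 2 = ((2 : ℝ) ^ k) ^ (2 * α) := by
      rw [← Real.rpow_mul_natCast hK.le]; congr 1; push_cast; ring
    have e2 : ((2 : ℝ) ^ (k + 1)) ^ (1 - 2 * α)
        = 2 ^ (k + 1) / (((2 : ℝ) ^ k) ^ (2 * α) * 2 ^ (2 * α)) := by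
      rw [Real.rpow_sub (by positivity), Real.rpow_one, pow_succ, Real.mul_rpow hK.le h2.le]
    have e3 : (1 / (cellCount f k : ℝ)) ^ s = 1 / (cellCount f k : ℝ) ^ s := by
      rw [Real.div_rpow one_pos.le hFpos.le, Real.one_rpow]
    rw [e1, e2, e3, Real.rpow_sub hFpos, Real.rpow_one]
    field_simp
  have hpow : ∀ k : ℕ, ((k : ℝ) + 2) ^ 2 * ρ ^ (k + 1) =
      (((k : ℝ) + 2) ^ 2 * ((2 : ℝ) ^ (k + 1)) ^ (1 - 2 * α)) *
        (((2 : ℝ) ^ (k + 1)) ^ τ) ^ (1 - s) := by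
    intro k
    have hK : (0 : ℝ) < 2 ^ (k + 1) := by positivity
    rw [← Real.rpow_mul hK.le, mul_assoc, ← Real.rpow_add hK, hρ, ← Real.rpow_mul_natCast h2.le,
      mul_comm e, Real.rpow_natCast_mul h2.le]
  refine (IsBigO.of_norm_le fun k => ?_).trans
    ((((isBigO_refl _ _).mul hFs).const_mul_left ((2 + 4 * Real.pi ^ 2) * 2 ^ (2 * α))).congr_right
      fun k => (hpow k).symm)
  rw [Real.norm_of_nonneg (by positivity)]
  exact hle k

theorem hausdorffMeasure_largeSumSet_ne_top {f : ℕ → ℕ} (hf : StrictMonoOn f (Set.Ici 1)) {τ : ℝ}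
    (hτ : 0 < τ) (hO : (fun n : ℕ => (f n : ℝ)) =O[atTop] (fun n : ℕ => (n : ℝ) ^ τ))
    {α : ℝ} (hα : 0 ≤ α) {s : ℝ} (hs : 1 - (2 * α - 1) / τ < s) (hs0 : 0 ≤ s) (hs1 : s ≤ 1) :
    MeasureTheory.Measure.hausdorffMeasure s (largeSumSet (fun n => (f n : ℝ)) α) ≠ ⊤ := by
  set u : ℕ → ℝ := fun k => ((largeCells f α k).card : ℝ) * (1 / (cellCount f k : ℝ)) ^ s with hu
  have hsum : Summable u := summable_card_largeCells_mul hf hτ hO hα hs hs1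
  have hu0 : ∀ k, 0 ≤ u k := fun k => by positivity
  have hr : Tendsto (fun n => ENNReal.ofReal (1 / (cellCount f n : ℝ))) atTop (nhds 0) := by
    rw [← ENNReal.ofReal_zero]
    exact ENNReal.tendsto_ofReal (tendsto_const_nhds.div_atTop
      (tendsto_natCast_atTop_atTop.comp (tendsto_cellCount hf)))
  have hmono : Monotone (cellCount f) := fun a b hab => Nat.succ_le_succ <|
    hf.monotoneOn (Set.mem_Ici.2 Nat.one_le_two_pow) (Set.mem_Ici.2 Nat.one_le_two_pow)
      (Nat.pow_le_pow_right two_pos (Nat.succ_le_succ hab))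
  have hle := MeasureTheory.Measure.hausdorffMeasure_le_liminf_tsum s
    (largeSumSet (fun n => (f n : ℝ)) α) _ hr
    (fun n (i : Σ k : ℕ, largeCells f α (n + k)) => gridCell (cellCount f (n + i.1)) i.2)
    (Eventually.of_forall fun n i => by
      rw [ediam_gridCell]
      have h1 : (0 : ℝ) < cellCount f n := by exact_mod_cast Nat.succ_pos _
      have h2 : (cellCount f n : ℝ) ≤ cellCount f (n + i.1) := by
        exact_mod_cast hmono (Nat.le_add_right _ _)
      exact ENNReal.ofReal_le_ofReal (one_div_le_one_div_of_le h1 h2))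
    (Eventually.of_forall fun n => largeSumSet_subset_iUnion_gridCell f α n)
  refine ne_top_of_le_ne_top (ENNReal.ofReal_ne_top (r := ∑' k, u k)) (hle.trans ?_)
  refine liminf_le_of_le (by isBoundedDefault) fun b hb => ?_
  obtain ⟨n, hn⟩ := hb.exists
  refine hn.trans ?_
  rw [ENNReal.tsum_sigma', ENNReal.ofReal_tsum_of_nonneg hu0 hsum]
  calc _ = ∑' k, ENNReal.ofReal (u (n + k)) := by
        congr 1
        funext k
        simp_rw [ediam_gridCell]
        rw [tsum_fintype, Finset.sum_const, Finset.card_univ, Fintype.card_coe, nsmul_eq_mul,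
          ENNReal.ofReal_rpow_of_nonneg (by positivity) hs0, hu,
          ENNReal.ofReal_mul (by positivity), ENNReal.ofReal_natCast]
    _ ≤ _ := ENNReal.tsum_comp_le_tsum_of_injective (add_right_injective n) _

theorem theorem3p7 (f : ℕ → ℕ) (hf : StrictMonoOn f (Set.Ici 1))
    (τ : ℝ) (hτ : 1 ≤ τ)
    (hO : (fun n : ℕ => (f n : ℝ)) =O[atTop] (fun n : ℕ => (n : ℝ) ^ τ))
    (α : ℝ) (hα₁ : 1 / 2 < α) (hα₂ : α < 1) :
    dimH (largeSumSet (fun n => (f n : ℝ)) α) ≤ ENNReal.ofReal (1 - (2 * α - 1) / τ) := by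
  have hτ0 : 0 < τ := by linarith
  have hpos : 0 < (2 * α - 1) / τ := div_pos (by linarith) hτ0
  have hlt : (2 * α - 1) / τ < 1 := (div_lt_one hτ0).2 (by linarith)
  set s₀ : ℝ := 1 - (2 * α - 1) / τ with hs₀
  -- The measure bound holds for each `s` in `(s₀, 1)`; then `s` decreases to `s₀`.
  have hev : ∀ᶠ s in nhdsWithin s₀ (Set.Ioi s₀),
      dimH (largeSumSet (fun n => (f n : ℝ)) α) ≤ ENNReal.ofReal s := by
    filter_upwards [Ioo_mem_nhdsGT (show s₀ < 1 by linarith)] with s hs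
    have hs0 : 0 ≤ s := by linarith [hs.1]
    have h := hausdorffMeasure_largeSumSet_ne_top hf hτ0 hO (by linarith) hs.1 hs0 hs.2.le
    rw [← Real.coe_toNNReal s hs0] at h
    exact dimH_le_of_hausdorffMeasure_ne_top h
  exact ge_of_tendsto (ENNReal.continuous_ofReal.continuousAt.mono_left nhdsWithin_le_nhds) hev
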